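/- Let $n$ be a natural number and $N=\{1,\dots,n\}$. For $x\in\mathbb{R}^n$ and $S\subseteq N$ write $x_S=\sum_{i\in S}x_i$, with $x_\emptyset=0$. Inequalities between vectors are coordinatewise. A set $X\subseteq\mathbb{R}^n$ is comprehensive if $x\in X$ and $y\le x$ imply $y\in X$, and it is bounded above if some $b\in\mathbb{R}^n$ satisfies $x\le b$ for all $x\in X$. Let $\mathcal{B}$ be the set of bargaining sets, i.e. of nonempty, closed, convex, comprehensive, bounded-above subsets of $\mathbb{R}^n$. For nonempty and bounded-above $X\subseteq\mathbb{R}^n$ let $\mathrm{ch}(X)$ be the smallest element of $\mathcal{B}$ containing $X$. For $B\in\mathcal{B}$ and $S\subseteq N$ let $c_B(S)=\sup_{x\in B}x_S$ (the worth of coalition $S$ in the stand-alone game of $B$; the supremum need not be attained). For a permutation $\rho$ of $N$ let $\rho(x)=(x_{\rho(i)})_{i\in N}$ and $\rho(B)=\{\rho(y):y\in B\}$. Let $B^*$ be the strong Pareto frontier of $B$, i.e. the set of $x\in B$ such that no $y\in B$ satisfies $y\ge x$ and $y\ne x$. A map $\psi:\mathcal{B}\to\mathbb{R}^n$ is a solution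 if $\psi_N(B):=\sum_{i\in N}\psi_i(B)\le c_B(N)$ for every $B\in\mathcal{B}$. Consider the following properties. 1. Efficiency: $\psi_N(B)\ge x_N$ for every $B\in\mathcal{B}$ and $x\in B$ (so that, for a solution, $\psi_N(B)=\max_{x\in B}x_N$). 2. Anonymity: $\psi(\rho(B))=\rho(\psi(B))$ for every permutation $\rho$ of $N$ and $B\in\mathcal{B}$. 3. Dummy property: if $B\in\mathcal{B}$ and $i\in N$ are such that $x_i=0$ for every $x\in B^*$, then $\psi_i(B)=0$. 4. Continuity: $\psi$ is Lipschitz continuous with respect to the Hausdorff metric on $\mathcal{B}$ and the Euclidean norm. 5. Additivity: $\psi(B+C)=\psi(B)+\psi(C)$ for all $B,C\in\mathcal{B}$, where $B+C$ is the Minkowski sum. 6. Monotonicity: for every $B\in\mathcal{B}$, $i\in N$ and $x\in\mathbb{R}^n$ such that some $y\in B$ satisfies $y_i\le x_i$ and $y_j=x_j$ for all $j\ne i$, one has $\psi_i(\mathrm{ch}(B\cup\{x\}))\ge\psi_i(B)$. Theorem. A map $\psi:\mathcal{B}\to\mathbb{R}^n$ is a solution satisfying efficiency, anonymity, the dummy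 property, continuity, additivity and monotonicity if and only if it is the Shapley value of the stand-alone game, that is, $$\psi_i(B)=\frac1n\sum_{S\subseteq N\setminus\{i\}}\binom{n-1}{|S|}^{-1}\bigl(c_B(S\cup\{i\})-c_B(S)\bigr)$$ for every $i\in N$ and $B\in\mathcal{B}$. -/

import Mathlib

open scoped NNReal ENNReal Pointwise

noncomputable section

namespace SocialChoice

/-- Utility profiles of `n` players: Euclidean space `ℝⁿ`. -/
abbrev Profile (n : ℕ) : Type := EuclideanSpace ℝ (Fin n)

/-- `X ⊆ ℝⁿ` is comprehensive: it is closed under lowering coordinates. -/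
def Comprehensive {n : ℕ} (X : Set (Profile n)) : Prop :=
  ∀ x ∈ X, ∀ y : Profile n, (∀ i, y i ≤ x i) → y ∈ X

/-- `X ⊆ ℝⁿ` is bounded above for the coordinatewise order. -/
def BoundedAbove {n : ℕ} (X : Set (Profile n)) : Prop :=
  ∃ b : Profile n, ∀ x ∈ X, ∀ i, x i ≤ b i

/-- An `n`-player bargaining set. -/
@[ext]
structure BargainingSet (n : ℕ) where
  carrier : Set (Profile n)
  nonempty : carrier.Nonempty
  isClosed : IsClosed carrier
  convex : Convex ℝ carrier
  comprehensive : Comprehensive carrier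
  boundedAbove : BoundedAbove carrier

variable {n : ℕ}

/-- The total utility `x_S` of the coalition `S` at the profile `x`. -/
def total (S : Finset (Fin n)) (x : Profile n) : ℝ := ∑ i ∈ S, x i

/-- The stand-alone claim of the coalition `S`, i.e. its worth in the stand-alone game: the
supremum of `x_S` over `x ∈ B` (a finite number, since `B` is nonempty and bounded above). -/
def claim (B : BargainingSet n) (S : Finset (Fin n)) : ℝ := sSup (total S '' B.carrier)

/-- The set `{x | x ≤ b}` is a bargaining set. -/
def orthant (b : Profile n) : BargainingSet n where
  carrier := {x | ∀ i, x i ≤ b i}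
  nonempty := ⟨b, fun _ => le_rfl⟩
  isClosed := by
    simp only [Set.ofPred_forall]
    exact isClosed_iInter fun i => isClosed_le (by fun_prop) continuous_const
  convex := by
    intro x hx y hy s t hs ht hst i
    have h1 := mul_le_mul_of_nonneg_left (hx i) hs
    have h2 := mul_le_mul_of_nonneg_left (hy i) ht
    have h3 : s * b i + t * b i = b i := by rw [← add_mul, hst, one_mul]
    simp only [PiLp.add_apply, PiLp.smul_apply, smul_eq_mul]
    linarith
  comprehensive := fun x hx y hy i => (hy i).trans (hx i)
  boundedAbove := ⟨b, fun _ hx => hx⟩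

/-- `ch X`: the smallest bargaining set that contains a nonempty, bounded above set `X`. -/
def ch (X : Set (Profile n)) (hne : X.Nonempty) (hb : BoundedAbove X) : BargainingSet n where
  carrier := {x | ∀ C : BargainingSet n, X ⊆ C.carrier → x ∈ C.carrier}
  nonempty := hne.imp fun _ hx _ hC => hC hx
  isClosed := by
    simp only [Set.ofPred_forall]
    exact isClosed_iInter fun C => isClosed_iInter fun _ => C.isClosed
  convex := fun _ hx _ hy _ _ hs ht hst C hC => C.convex (hx C hC) (hy C hC) hs ht hst
  comprehensive := fun x hx y hy C hC => C.comprehensive x (hx C hC) y hy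
  boundedAbove := by
    obtain ⟨b, hb⟩ := hb
    exact ⟨b, fun x hx => hx (orthant b) hb⟩

theorem BoundedAbove.insert {X : Set (Profile n)} (hX : BoundedAbove X) (x : Profile n) :
    BoundedAbove (insert x X) := by
  obtain ⟨b, hb⟩ := hX
  refine ⟨WithLp.toLp 2 fun i => max (x i) (b i), ?_⟩
  rintro y (rfl | hy) i
  · exact le_max_left _ _
  · exact (hb y hy i).trans (le_max_right _ _)

/-- `ch (B ∪ {x})`. -/
def adjoin (B : BargainingSet n) (x : Profile n) : BargainingSet n :=
  ch (insert x B.carrier) (Set.insert_nonempty x B.carrier) (B.boundedAbove.insert x)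

/-- The permuted profile `ρ(x) = (x_{ρ(i)})_i`. -/
def permute (ρ : Equiv.Perm (Fin n)) (x : Profile n) : Profile n :=
  WithLp.toLp 2 fun i => x (ρ i)

theorem permute_image (ρ : Equiv.Perm (Fin n)) (X : Set (Profile n)) :
    permute ρ '' X = {x | permute ρ.symm x ∈ X} := by
  ext x
  constructor
  · rintro ⟨y, hy, rfl⟩
    have : permute ρ.symm (permute ρ y) = y := by ext i; simp [permute]
    simpa [this] using hy
  · intro hx
    exact ⟨_, hx, by ext i; simp [permute]⟩

/-- The permuted bargaining set `ρ(B) = {ρ(y) | y ∈ B}`. -/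
def permuteSet (ρ : Equiv.Perm (Fin n)) (B : BargainingSet n) : BargainingSet n where
  carrier := permute ρ '' B.carrier
  nonempty := B.nonempty.image _
  isClosed := by
    rw [permute_image]
    refine B.isClosed.preimage ?_
    unfold permute
    fun_prop
  convex := by
    rw [permute_image]
    intro x hx y hy s t hs ht hst
    have := B.convex hx hy hs ht hst
    exact this
  comprehensive := by
    rw [permute_image]
    intro x hx y hy
    exact B.comprehensive _ hx _ fun i => hy _
  boundedAbove := by
    obtain ⟨b, hb⟩ := B.boundedAbove
    refine ⟨permute ρ b, ?_⟩
    rintro _ ⟨y, hy, rfl⟩ i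
    exact hb y hy (ρ i)

theorem isClosed_add (B C : BargainingSet n) : IsClosed (B.carrier + C.carrier) := by
  obtain ⟨b, hb⟩ := B.boundedAbove
  obtain ⟨c, hc⟩ := C.boundedAbove
  refine isClosed_of_closure_subset fun x hx => ?_
  -- Near `x`, only a compact part `K` of `B` matters.
  let I : Set (Profile n) := {y | ∀ i, x i - 1 - c i ≤ y i ∧ y i ≤ b i}
  have hI : IsCompact I := by
    have h1 : IsCompact (Set.Icc (fun i => x i - 1 - c i) (fun i => b i) : Set (Fin n → ℝ)) :=
      isCompact_Icc
    have h2 := h1.image (PiLp.continuous_toLp 2 fun _ : Fin n => ℝ)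
    convert h2 using 1
    ext y
    constructor
    · intro hy
      exact ⟨y.ofLp, ⟨fun i => (hy i).1, fun i => (hy i).2⟩, rfl⟩
    · rintro ⟨z, hz, rfl⟩ i
      exact ⟨hz.1 i, hz.2 i⟩
  have hK : IsCompact (B.carrier ∩ I) := hI.inter_left B.isClosed
  have hcl : IsClosed (B.carrier ∩ I + C.carrier) := C.isClosed.add_left_of_isCompact hK
  have hsub : B.carrier ∩ I + C.carrier ⊆ B.carrier + C.carrier :=
    Set.add_subset_add_right Set.inter_subset_left
  refine hsub (hcl.closure_eq ▸ ?_)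
  rw [Metric.mem_closure_iff] at hx ⊢
  intro ε hε
  obtain ⟨u, hu, hd⟩ := hx (min ε 1) (lt_min hε one_pos)
  refine ⟨u, ?_, hd.trans_le (min_le_left _ _)⟩
  obtain ⟨p, hp, q, hq, rfl⟩ := hu
  refine ⟨p, ⟨hp, fun i => ⟨?_, hb p hp i⟩⟩, q, hq, rfl⟩
  have h1 : ‖(x - (p + q)) i‖ ≤ ‖x - (p + q)‖ := PiLp.norm_apply_le _ i
  have h2 : ‖x - (p + q)‖ < 1 := by
    rw [← dist_eq_norm]
    exact hd.trans_le (min_le_right _ _)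
  have h3 := (abs_lt.1 (h1.trans_lt h2)).2
  have h4 := hc q hq i
  simp only [PiLp.sub_apply, PiLp.add_apply] at h3
  linarith

/-- The Minkowski sum of two bargaining sets. -/
instance : Add (BargainingSet n) where
  add B C :=
    { carrier := B.carrier + C.carrier
      nonempty := B.nonempty.add C.nonempty
      isClosed := isClosed_add B C
      convex := B.convex.add C.convex
      comprehensive := by
        rintro _ ⟨p, hp, q, hq, rfl⟩ y hy
        refine ⟨y - q, B.comprehensive p hp _ fun i => ?_, q, hq, sub_add_cancel y q⟩
        have := hy i
        simp only [PiLp.sub_apply, PiLp.add_apply] at this ⊢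
        linarith
      boundedAbove := by
        obtain ⟨b, hb⟩ := B.boundedAbove
        obtain ⟨c, hc⟩ := C.boundedAbove
        refine ⟨b + c, ?_⟩
        rintro _ ⟨p, hp, q, hq, rfl⟩ i
        exact add_le_add (hb p hp i) (hc q hq i) }

/-- The strong Pareto frontier of `X`: the points of `X` that no other point of `X` weakly
exceeds in every coordinate. -/
def paretoFrontier (X : Set (Profile n)) : Set (Profile n) :=
  {x ∈ X | ¬ ∃ y ∈ X, (∀ i, x i ≤ y i) ∧ y ≠ x}

/-- A map `ψ` is a solution if its values are feasible with transfers: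
`ψ_N(B) ≤ max_{x ∈ B} x_N`. -/
def IsSolution (ψ : BargainingSet n → Profile n) : Prop :=
  ∀ B, total Finset.univ (ψ B) ≤ claim B Finset.univ

/-- Efficiency: no point of `B` has a larger total utility than `ψ(B)`.  (For a solution this
means `ψ_N(B) = max_{x ∈ B} x_N`.) -/
def Efficiency (ψ : BargainingSet n → Profile n) : Prop :=
  ∀ B, ∀ x ∈ B.carrier, total Finset.univ x ≤ total Finset.univ (ψ B)

def Anonymity (ψ : BargainingSet n → Profile n) : Prop :=
  ∀ (ρ : Equiv.Perm (Fin n)) (B : BargainingSet n), ψ (permuteSet ρ B) = permute ρ (ψ B)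

def DummyProperty (ψ : BargainingSet n → Profile n) : Prop :=
  ∀ (B : BargainingSet n) (i : Fin n),
    (∀ x ∈ paretoFrontier B.carrier, x i = 0) → ψ B i = 0

/-- Lipschitz continuity with respect to the Hausdorff metric (for the Euclidean norm). -/
def LipschitzContinuity (ψ : BargainingSet n → Profile n) : Prop :=
  ∃ K : ℝ≥0, ∀ B C : BargainingSet n,
    edist (ψ B) (ψ C) ≤ K * Metric.hausdorffEDist B.carrier C.carrier

def Additivity (ψ : BargainingSet n → Profile n) : Prop :=
  ∀ B C : BargainingSet n, ψ (B + C) = ψ B + ψ C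

/-- Monotonicity: raising the utility of player `i` at some point of `B` and adjoining the
resulting point to `B` does not hurt player `i`. -/
def Monotonicity (ψ : BargainingSet n → Profile n) : Prop :=
  ∀ (B : BargainingSet n) (i : Fin n) (x : Profile n),
    (∃ y ∈ B.carrier, y i ≤ x i ∧ ∀ j, j ≠ i → y j = x j) → ψ B i ≤ ψ (adjoin B x) i

/-- The Shapley value of the stand-alone game. -/
def standAloneShapley (B : BargainingSet n) : Profile n :=
  WithLp.toLp 2 fun i =>
    1 / (n : ℝ) * ∑ S ∈ (Finset.univ.erase i).powerset,
      (((n - 1).choose S.card : ℕ) : ℝ)⁻¹ * (claim B (insert i S) - claim B S)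

end SocialChoice

end

/-!
The proof works with support functions `h_B w = sup_{x ∈ B} ∑ i, w i * x i` on the orthant of
nonnegative weights. They determine `B` (Hahn–Banach), turn Minkowski sums into sums, and their
differences form a vector lattice that is also closed under dropping the weights of some players.
An additive `ψ` therefore extends to an additive functional `L i` on these differences for each
player `i`.

The axioms become properties of these functionals (`IsValueFunctional`): efficiency says
`∑ i, L i f = f 1`, the dummy property says that `L i f = 0` if `f` does not depend on `w i`, and
anonymity is symmetry. Monotonicity and Lipschitz continuity give positivity: `0 ≤ L i f` if `0 ≤ f`
and `f` vanishes where `w i = 0` (`apply_le_of_supportFn_le`). Indeed, if `C ⊆ B` have support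
functions that agree at all weights ignoring `i`, then slightly lowered points of `B` can be adjoined
to `C` in the direction of `i`, and by Dickson's lemma finitely many of them suffice to come
arbitrarily close to `B` in the Hausdorff metric.

Two such families of functionals agree. By downward induction on the number of nonzero weights it
suffices to treat a function `f` of the weights of the players in `T` that vanishes as soon as one of
these weights does. Outside `T` all players are dummies. A multiple of the unanimity function
`min_{i ∈ T} w i` is settled by symmetry and efficiency, and after subtracting it one may assume
`f 1 = 0`; then the positive and negative parts of `f` yield nonnegative amounts that sum to zero.

As `h_B` at the indicator of a coalition is its worth, the Shapley value of the stand-alone game is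
readily seen to have the six properties, so it is the unique map that does.
-/

open scoped NNReal ENNReal Pointwise

noncomputable section

namespace SocialChoice

variable {n : ℕ}

/-! ### Support functions -/

/-- The weighted utilitarian total `∑ i, w i * x i`, for nonnegative weights `w`. -/
def weighted (w : Fin n → ℝ≥0) (x : Profile n) : ℝ := ∑ i, (w i : ℝ) * x i

theorem weighted_add (w : Fin n → ℝ≥0) (x y : Profile n) :
    weighted w (x + y) = weighted w x + weighted w y := by
  simp [weighted, mul_add, Finset.sum_add_distrib]

theorem weighted_sub (w : Fin n → ℝ≥0) (x y : Profile n) :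
    weighted w (x - y) = weighted w x - weighted w y := by
  simp [weighted, mul_sub, Finset.sum_sub_distrib]

theorem weighted_smul (w : Fin n → ℝ≥0) (c : ℝ) (x : Profile n) :
    weighted w (c • x) = c * weighted w x := by
  simp [weighted, Finset.mul_sum, mul_left_comm]

theorem weighted_mono (w : Fin n → ℝ≥0) {x y : Profile n} (h : ∀ i, x i ≤ y i) :
    weighted w x ≤ weighted w y :=
  Finset.sum_le_sum fun i _ => mul_le_mul_of_nonneg_left (h i) (w i).coe_nonneg

theorem continuous_weighted (w : Fin n → ℝ≥0) : Continuous (weighted w) := by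
  unfold weighted
  fun_prop

theorem weighted_single (i : Fin n) (x : Profile n) : weighted (Pi.single i 1) x = x i := by
  rw [weighted, Finset.sum_eq_single i] <;> simp +contextual

theorem weighted_unit (w : Fin n → ℝ≥0) (i : Fin n) :
    weighted w (EuclideanSpace.single i (1 : ℝ)) = w i := by
  rw [weighted, Finset.sum_eq_single i] <;> simp +contextual

/-- The support function of a bargaining set on the nonnegative orthant of weights. -/
def supportFn (B : BargainingSet n) (w : Fin n → ℝ≥0) : ℝ := sSup (weighted w '' B.carrier)

theorem isLUB_supportFn (B : BargainingSet n) (w : Fin n → ℝ≥0) :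
    IsLUB (weighted w '' B.carrier) (supportFn B w) := by
  refine isLUB_csSup (B.nonempty.image _) ?_
  obtain ⟨b, hb⟩ := B.boundedAbove
  refine ⟨weighted w b, ?_⟩
  rintro _ ⟨x, hx, rfl⟩
  exact weighted_mono w (hb x hx)

theorem weighted_le_supportFn {B : BargainingSet n} (w : Fin n → ℝ≥0) {x : Profile n}
    (hx : x ∈ B.carrier) : weighted w x ≤ supportFn B w :=
  (isLUB_supportFn B w).1 ⟨x, hx, rfl⟩

theorem supportFn_le_iff {B : BargainingSet n} {w : Fin n → ℝ≥0} {c : ℝ} :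
    supportFn B w ≤ c ↔ ∀ x ∈ B.carrier, weighted w x ≤ c := by
  rw [isLUB_le_iff (isLUB_supportFn B w)]
  simp [upperBounds]

theorem supportFn_zero (B : BargainingSet n) : supportFn B 0 = 0 := by
  obtain ⟨y, hy⟩ := B.nonempty
  refine le_antisymm (supportFn_le_iff.2 fun y _ => by simp [weighted]) ?_
  simpa [weighted] using weighted_le_supportFn (0 : Fin n → ℝ≥0) hy

theorem supportFn_mono {B C : BargainingSet n} (h : B.carrier ⊆ C.carrier) (w : Fin n → ℝ≥0) :
    supportFn B w ≤ supportFn C w :=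
  supportFn_le_iff.2 fun _ hx => weighted_le_supportFn w (h hx)

theorem supportFn_add (B C : BargainingSet n) (w : Fin n → ℝ≥0) :
    supportFn (B + C) w = supportFn B w + supportFn C w := by
  refine (isLUB_supportFn (B + C) w).unique ?_
  have h := (isLUB_supportFn B w).add (isLUB_supportFn C w)
  convert h using 1
  ext r
  constructor
  · rintro ⟨_, ⟨x, hx, y, hy, rfl⟩, rfl⟩
    exact ⟨_, ⟨x, hx, rfl⟩, _, ⟨y, hy, rfl⟩, (weighted_add w x y).symm⟩
  · rintro ⟨_, ⟨x, hx, rfl⟩, _, ⟨y, hy, rfl⟩, rfl⟩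
    exact ⟨x + y, ⟨x, hx, y, hy, rfl⟩, weighted_add w x y⟩

theorem supportFn_orthant (b : Profile n) (w : Fin n → ℝ≥0) :
    supportFn (orthant b) w = weighted w b :=
  le_antisymm (supportFn_le_iff.2 fun _ hx => weighted_mono w hx)
    (weighted_le_supportFn w (B := orthant b) fun _ => le_rfl)

theorem weighted_permute (ρ : Equiv.Perm (Fin n)) (w : Fin n → ℝ≥0) (x : Profile n) :
    weighted w (permute ρ x) = weighted (w ∘ ρ.symm) x := by
  rw [weighted, weighted, ← Equiv.sum_comp ρ fun i => ((w ∘ ρ.symm) i : ℝ) * x i]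
  simp [permute]

theorem supportFn_permuteSet (ρ : Equiv.Perm (Fin n)) (B : BargainingSet n) (w : Fin n → ℝ≥0) :
    supportFn (permuteSet ρ B) w = supportFn B (w ∘ ρ.symm) := by
  rw [supportFn, supportFn]
  congr 1
  change weighted w '' (permute ρ '' B.carrier) = _
  rw [Set.image_image]
  simp only [weighted_permute]

/-- A point outside the closure of a convex comprehensive set is separated from it by
*nonnegative* weights. -/
theorem exists_weight_of_notMem_closure {P : Set (Profile n)} (hne : P.Nonempty)
    (hconv : Convex ℝ P) (hcomp : Comprehensive P) {x : Profile n} (hx : x ∉ closure P) :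
    ∃ (w : Fin n → ℝ≥0) (u : ℝ), (∀ p ∈ P, weighted w p < u) ∧ u < weighted w x := by
  obtain ⟨f, u, hf, hu⟩ := geometric_hahn_banach_closed_point hconv.closure isClosed_closure hx
  have hf' : ∀ p ∈ P, f p < u := fun p hp => hf p (subset_closure hp)
  have hsum : ∀ y : Profile n, f y = ∑ i, y i * f (EuclideanSpace.single i 1) := by
    intro y
    conv_lhs => rw [← (EuclideanSpace.basisFun (Fin n) ℝ).sum_repr y]
    simp
  have hpos : ∀ i, 0 ≤ f (EuclideanSpace.single i 1) := by
    intro i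
    by_contra! hneg
    obtain ⟨p, hp⟩ := hne
    -- Lowering the `i`th coordinate of `p` far enough would push `f` beyond `u`.
    set c := f (EuclideanSpace.single i 1) with hc
    have ht : 0 ≤ (u - f p) / (-c) := div_nonneg (by linarith [hf' p hp]) (by linarith)
    have hq : p - ((u - f p) / (-c)) • EuclideanSpace.single i (1 : ℝ) ∈ P := by
      refine hcomp p hp _ fun j => ?_
      simp only [PiLp.sub_apply, PiLp.smul_apply, smul_eq_mul, PiLp.single_apply]
      split_ifs <;> simp [ht]
    have h1 := hf' _ hq
    rw [map_sub, map_smul, smul_eq_mul, ← hc] at h1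
    have h2 : (u - f p) / (-c) * c = -(u - f p) := by
      rw [div_neg, neg_mul, div_mul_cancel₀ _ hneg.ne]
    linarith
  have hw : ∀ y, weighted (fun i => (f (EuclideanSpace.single i 1)).toNNReal) y = f y := by
    intro y
    simp only [weighted, hsum y, Real.coe_toNNReal _ (hpos _), mul_comm]
  exact ⟨_, u, fun p hp => (hw p).trans_lt (hf' p hp), hu.trans_eq (hw x).symm⟩

theorem subset_of_supportFn_le {B C : BargainingSet n} (h : ∀ w, supportFn B w ≤ supportFn C w) :
    B.carrier ⊆ C.carrier := by
  intro x hx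
  by_contra hxC
  rw [← C.isClosed.closure_eq] at hxC
  obtain ⟨w, u, hw, hu⟩ := exists_weight_of_notMem_closure C.nonempty C.convex C.comprehensive hxC
  have h1 : supportFn C w ≤ u := supportFn_le_iff.2 fun p hp => (hw p hp).le
  linarith [h w, weighted_le_supportFn w hx]

theorem supportFn_injective : Function.Injective (supportFn (n := n)) := fun _ _ h =>
  BargainingSet.ext <| (subset_of_supportFn_le fun w => (congrFun h w).le).antisymm
    (subset_of_supportFn_le fun w => (congrFun h w).ge)

/-- The bargaining set cut out by prescribed upper bounds `g w` on all weighted totals. -/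
def ofBounds (g : (Fin n → ℝ≥0) → ℝ) (hne : ∃ x, ∀ w, weighted w x ≤ g w) : BargainingSet n where
  carrier := {x | ∀ w, weighted w x ≤ g w}
  nonempty := hne
  isClosed := by
    simp only [Set.ofPred_forall]
    exact isClosed_iInter fun w => isClosed_le (continuous_weighted w) continuous_const
  convex := by
    intro x hx y hy s t hs ht hst w
    have h1 := mul_le_mul_of_nonneg_left (hx w) hs
    have h2 := mul_le_mul_of_nonneg_left (hy w) ht
    have h3 : s * g w + t * g w = g w := by rw [← add_mul, hst, one_mul]
    rw [weighted_add, weighted_smul, weighted_smul]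
    linarith
  comprehensive := fun x hx y hy w => (weighted_mono w hy).trans (hx w)
  boundedAbove := ⟨WithLp.toLp 2 fun i => g (Pi.single i 1), fun x hx i => by
    simpa [weighted_single] using hx (Pi.single i 1)⟩

theorem supportFn_ofBounds {g : (Fin n → ℝ≥0) → ℝ} (hne : ∃ x, ∀ w, weighted w x ≤ g w)
    (hg : ∀ w c, (∀ x, (∀ v, weighted v x ≤ g v) → weighted w x ≤ c) → g w ≤ c) :
    supportFn (ofBounds g hne) = g := by
  ext w
  exact le_antisymm (supportFn_le_iff.2 fun x hx => hx w)
    (hg w _ fun x hx => weighted_le_supportFn w (B := ofBounds g hne) hx)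

/-- The support function of `ch (B ∪ C)` is `max (h_B, h_C)`. -/
theorem exists_supportFn_eq_sup (B C : BargainingSet n) :
    ∃ D : BargainingSet n, supportFn D = supportFn B ⊔ supportFn C := by
  obtain ⟨x, hx⟩ := B.nonempty
  refine ⟨ofBounds _ ⟨x, fun w => (weighted_le_supportFn w hx).trans le_sup_left⟩,
    supportFn_ofBounds _ fun w c h => sup_le ?_ ?_⟩
  · exact supportFn_le_iff.2 fun y hy =>
      h y fun v => (weighted_le_supportFn v hy).trans le_sup_left
  · exact supportFn_le_iff.2 fun y hy =>
      h y fun v => (weighted_le_supportFn v hy).trans le_sup_right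

/-- Replace by `0` the weights of the players outside `T`. -/
def restrict (T : Finset (Fin n)) (w : Fin n → ℝ≥0) : Fin n → ℝ≥0 :=
  fun i => if i ∈ T then w i else 0

theorem restrict_restrict (T U : Finset (Fin n)) (w : Fin n → ℝ≥0) :
    restrict T (restrict U w) = restrict (T ∩ U) w := by
  ext i
  by_cases h1 : i ∈ T <;> by_cases h2 : i ∈ U <;> simp [restrict, h1, h2]

/-- The bargaining set in which the players of `T` face `B` while all others are dummies. Its
support function is that of `B` after the weights outside `T` are dropped. -/
theorem exists_supportFn_eq_restrict (B : BargainingSet n) (T : Finset (Fin n)) :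
    ∃ D : BargainingSet n, (∀ w, supportFn D w = supportFn B (restrict T w)) ∧
      ∀ i ∉ T, ∀ x ∈ paretoFrontier D.carrier, x i = 0 := by
  have hproj : ∀ (y : Profile n) (w : Fin n → ℝ≥0),
      weighted w (WithLp.toLp 2 fun i => if i ∈ T then y i else 0) = weighted (restrict T w) y := by
    intro y w
    refine Finset.sum_congr rfl fun i _ => ?_
    by_cases h : i ∈ T <;> simp [restrict, h]
  have hmem : ∀ y ∈ B.carrier, ∀ w,
      weighted w (WithLp.toLp 2 fun i => if i ∈ T then y i else 0) ≤
        supportFn B (restrict T w) := fun y hy w => by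
    rw [hproj]
    exact weighted_le_supportFn _ hy
  obtain ⟨x₀, hx₀⟩ := B.nonempty
  refine ⟨ofBounds (fun w => supportFn B (restrict T w)) ⟨_, hmem x₀ hx₀⟩, fun w => ?_, ?_⟩
  · rw [supportFn_ofBounds]
    intro w c h
    refine supportFn_le_iff.2 fun y hy => ?_
    rw [← hproj]
    exact h _ (hmem y hy)
  · rintro i hi x ⟨hx, hmax⟩
    -- Dropping the weights outside `T` does not change the bounds, so raising `x i` to `0` keeps
    -- `x` in the set.
    have hzero : ∀ v : Fin n → ℝ≥0, (∀ j ∈ T, v j = 0) → supportFn B (restrict T v) = 0 := by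
      intro v hv
      have : restrict T v = 0 := by
        ext j
        by_cases h : j ∈ T <;> simp [restrict, h, hv]
      rw [this, supportFn_zero]
    have hxi : x i ≤ 0 := by
      have := hx (Pi.single i 1)
      rw [weighted_single] at this
      exact this.trans_eq (hzero _ fun j hj => Pi.single_eq_of_ne (by grind) _)
    by_contra hne
    refine hmax ⟨WithLp.toLp 2 (Function.update x i 0), fun w => ?_, fun j => ?_, ?_⟩
    · have h1 : weighted w (WithLp.toLp 2 (Function.update x i 0)) =
          weighted (Function.update w i 0) x := by
        refine Finset.sum_congr rfl fun j _ => ?_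
        by_cases h : j = i
        · subst h; simp
        · simp [h]
      have h2 : restrict T (Function.update w i 0) = restrict T w := by
        ext j
        by_cases h : j ∈ T
        · have : j ≠ i := by grind
          simp [restrict, h, this]
        · simp [restrict, h]
      have h3 := hx (Function.update w i 0)
      rw [h1]
      simpa only [h2] using h3
    · by_cases h : j = i
      · subst h; simpa using hxi
      · simp [h]
    · intro h
      apply hne
      rw [← h]
      simp

/-! ### Monotonicity in the direction of a player -/

/-- Up to `ε` in every coordinate, a bounded above set is dominated by finitely many of its points.
After rounding, this is Dickson's lemma: subsets of `ℕⁿ` have finitely many minimal elements. -/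
theorem exists_finset_approx_dominating {X : Set (Profile n)} (hb : BoundedAbove X) {ε : ℝ}
    (hε : 0 < ε) :
    ∃ F : Finset (Profile n), (∀ f ∈ F, f ∈ X) ∧ ∀ x ∈ X, ∃ f ∈ F, ∀ i, x i ≤ f i + ε := by
  obtain ⟨b, hb⟩ := hb
  let m : Profile n → Fin n → ℕ := fun x i => ⌊(b i - x i) / ε⌋₊
  let M : Set (Fin n → ℕ) := {a | Minimal (fun a => ∃ x ∈ X, m x = a) a}
  have hM : M.Finite :=
    WellQuasiOrderedLE.finite_of_isAntichain (setOfPred_minimal_antichain _)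
  have hex : ∀ a ∈ M, ∃ x ∈ X, m x = a := fun a ha =>
    (show Minimal (fun a => ∃ x ∈ X, m x = a) a from ha).prop
  choose! r hr using hex
  classical
  refine ⟨hM.toFinset.image r, fun f hf => ?_, fun x hx => ?_⟩
  · obtain ⟨a, ha, rfl⟩ := Finset.mem_image.1 hf
    exact (hr a (hM.mem_toFinset.1 ha)).1
  · obtain ⟨a, hle, ha⟩ :=
      exists_minimal_le_of_wellFoundedLT (fun a => ∃ x ∈ X, m x = a) (m x) ⟨x, hx, rfl⟩
    obtain ⟨h1, h2⟩ := hr a ha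
    refine ⟨r a, Finset.mem_image.2 ⟨a, hM.mem_toFinset.2 ha, rfl⟩, fun i => ?_⟩
    have h3 : (⌊(b i - r a i) / ε⌋₊ : ℝ) ≤ (⌊(b i - x i) / ε⌋₊ : ℝ) := by
      have : m (r a) i ≤ m x i := by rw [h2]; exact hle i
      exact_mod_cast this
    have h4 := Nat.lt_floor_add_one ((b i - r a i) / ε)
    have h5 := Nat.floor_le (div_nonneg (sub_nonneg.2 (hb x hx i)) hε.le)
    have h6 : (b i - r a i) / ε < (b i - x i) / ε + 1 := by linarith
    rw [div_add_one hε.ne', div_lt_div_iff_of_pos_right hε] at h6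
    linarith

/-- If the support function of `C` is at least that of `B` at all weights ignoring player `i`, then
any point of `B`, slightly lowered, enters `C` once the utility of player `i` is lowered far enough. -/
theorem exists_lower_mem {B C : BargainingSet n} {i : Fin n}
    (h : ∀ w : Fin n → ℝ≥0, w i = 0 → supportFn B w ≤ supportFn C w) {x y : Profile n}
    (hx : x ∈ B.carrier) (hxy : ∀ j, y j < x j) :
    ∃ z ∈ C.carrier, z i ≤ y i ∧ ∀ j, j ≠ i → z j = y j := by
  -- `P` is `C` extended to infinity in the direction of player `i`.
  let P : Set (Profile n) := {p | ∃ z ∈ C.carrier, ∀ j, j ≠ i → z j = p j}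
  have hconv : Convex ℝ P := by
    rintro p ⟨z, hz, hzp⟩ q ⟨z', hz', hzq⟩ s t hs ht hst
    exact ⟨_, C.convex hz hz' hs ht hst, fun j hj => by simp [hzp j hj, hzq j hj]⟩
  have hcomp : Comprehensive P := by
    rintro p ⟨z, hz, hzp⟩ q hq
    refine ⟨WithLp.toLp 2 (Function.update q i (z i)), C.comprehensive z hz _ fun j => ?_,
      fun j hj => by simp [hj]⟩
    by_cases hj : j = i
    · subst hj; simp
    · simpa [hj, hzp j hj] using hq j
  have hCP : ∀ z ∈ C.carrier, z ∈ P := fun z hz => ⟨z, hz, fun _ _ => rfl⟩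
  have hxP : x ∈ closure P := by
    by_contra hxP
    obtain ⟨w, u, hw, hu⟩ :=
      exists_weight_of_notMem_closure (C.nonempty.mono hCP) hconv hcomp hxP
    have hwi : w i = 0 := by
      by_contra hne
      have hpos : (0 : ℝ) < w i := NNReal.coe_pos.2 (pos_iff_ne_zero.2 hne)
      obtain ⟨z, hz⟩ := C.nonempty
      have hmem : z + ((u - weighted w z) / w i) • EuclideanSpace.single i (1 : ℝ) ∈ P :=
        ⟨z, hz, fun j hj => by simp [hj]⟩
      have h1 := hw _ hmem
      rw [weighted_add, weighted_smul, weighted_unit, div_mul_cancel₀ _ hpos.ne'] at h1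
      linarith
    have h1 : supportFn C w ≤ u := supportFn_le_iff.2 fun p hp => (hw p (hCP p hp)).le
    linarith [h w hwi, weighted_le_supportFn w hx]
  -- The points strictly above `y` form a neighbourhood of `x`, so one of them lies in `P`.
  have hopen : IsOpen {p : Profile n | ∀ j, y j < p j} := by
    simp only [Set.ofPred_forall]
    exact isOpen_iInter_of_finite fun j => isOpen_lt continuous_const (by fun_prop)
  obtain ⟨p, hyp, hp⟩ := mem_closure_iff.1 hxP _ hopen hxy
  obtain ⟨z, hz, hzy⟩ := hcomp p hp y fun j => (hyp j).le
  refine ⟨WithLp.toLp 2 (Function.update y i (min (z i) (y i))), C.comprehensive z hz _ fun j => ?_,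
    by simp, fun j hj => by simp [hj]⟩
  by_cases hj : j = i
  · subst hj; simp
  · simp [hj, hzy j hj]

/-- Adjoining finitely many points in the direction of player `i` does not hurt `i`. -/
theorem Monotonicity.exists_superset {ψ : BargainingSet n → Profile n} (hψ : Monotonicity ψ)
    {B C : BargainingSet n} (hCB : C.carrier ⊆ B.carrier) (i : Fin n) (F : Finset (Profile n))
    (hF : ∀ x ∈ F, x ∈ B.carrier ∧ ∃ z ∈ C.carrier, z i ≤ x i ∧ ∀ j, j ≠ i → z j = x j) :
    ∃ E : BargainingSet n, C.carrier ⊆ E.carrier ∧ E.carrier ⊆ B.carrier ∧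
      (∀ x ∈ F, x ∈ E.carrier) ∧ ψ C i ≤ ψ E i := by
  classical
  induction F using Finset.induction_on with
  | empty => exact ⟨C, subset_rfl, hCB, by simp, le_rfl⟩
  | insert x F _ ih =>
    obtain ⟨E, hCE, hEB, hFE, hle⟩ := ih fun y hy => hF y (Finset.mem_insert_of_mem hy)
    obtain ⟨hxB, z, hz, hzi, hzj⟩ := hF x (Finset.mem_insert_self x F)
    have hsub : insert x E.carrier ⊆ (adjoin E x).carrier := fun y hy D hD => hD hy
    refine ⟨adjoin E x, fun y hy => hsub (Or.inr (hCE hy)),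
      fun y hy => hy B (Set.insert_subset hxB hEB), fun y hy => ?_,
      hle.trans (hψ E i x ⟨z, hCE hz, hzi, hzj⟩)⟩
    rcases Finset.mem_insert.1 hy with rfl | hy
    · exact hsub (Or.inl rfl)
    · exact hsub (Or.inr (hFE y hy))

/-- Monotonicity and Lipschitz continuity give positivity: enlarging `C` to `B` without changing
the support function at the weights that ignore player `i` does not hurt `i`. -/
theorem apply_le_of_supportFn_le {ψ : BargainingSet n → Profile n} (hmono : Monotonicity ψ)
    (hlip : LipschitzContinuity ψ) {B C : BargainingSet n} {i : Fin n}
    (hle : ∀ w, supportFn C w ≤ supportFn B w)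
    (heq : ∀ w : Fin n → ℝ≥0, w i = 0 → supportFn B w = supportFn C w) : ψ C i ≤ ψ B i := by
  obtain ⟨K, hK⟩ := hlip
  have hCB := subset_of_supportFn_le hle
  let e : Profile n := WithLp.toLp 2 fun _ => 1
  have key : ∀ ε > 0, ψ C i ≤ ψ B i + K * (2 * ε * ‖e‖) := by
    intro ε hε
    obtain ⟨F, hFB, hF⟩ := exists_finset_approx_dominating B.boundedAbove hε
    classical
    obtain ⟨E, hCE, hEB, hFE, hψ⟩ :=
      hmono.exists_superset hCB i (F.image fun f => f - ε • e) <| by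
        intro x hx
        obtain ⟨f, hf, rfl⟩ := Finset.mem_image.1 hx
        have hlt : ∀ j, (f - ε • e) j < f j := fun j => by simpa [e] using hε
        exact ⟨B.comprehensive f (hFB f hf) _ fun j => (hlt j).le,
          exists_lower_mem (fun w hw => (heq w hw).le) (hFB f hf) hlt⟩
    have hd : Metric.hausdorffEDist E.carrier B.carrier ≤ ENNReal.ofReal (2 * ε * ‖e‖) := by
      refine Metric.hausdorffEDist_le_of_mem_edist
        (fun x hx => ⟨x, hEB hx, by simp⟩) fun x hx => ?_
      obtain ⟨f, hf, hxf⟩ := hF x hx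
      refine ⟨x - (2 * ε) • e,
        E.comprehensive _ (hFE _ (Finset.mem_image_of_mem _ hf)) _ fun j => ?_, ?_⟩
      · have := hxf j
        simp only [e, PiLp.sub_apply, PiLp.smul_apply, smul_eq_mul, mul_one]
        linarith
      · rw [edist_dist, dist_eq_norm, sub_sub_cancel, norm_smul, Real.norm_of_nonneg (by positivity)]
    have h1 : dist (ψ E) (ψ B) ≤ K * (2 * ε * ‖e‖) := by
      have h2 := (hK E B).trans (mul_le_mul_right hd (K : ℝ≥0∞))
      rw [← ENNReal.ofReal_coe_nnreal, ← ENNReal.ofReal_mul K.coe_nonneg, edist_dist] at h2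
      exact (ENNReal.ofReal_le_ofReal_iff (by positivity)).1 h2
    have h3 : ‖(ψ E - ψ B) i‖ ≤ ‖ψ E - ψ B‖ := PiLp.norm_apply_le _ i
    rw [← dist_eq_norm] at h3
    have h4 := (le_abs_self _).trans (h3.trans h1)
    rw [PiLp.sub_apply] at h4
    linarith
  refine le_of_forall_pos_le_add fun δ hδ => ?_
  have hpos : 0 < K * (2 * ‖e‖) + 1 := by positivity
  refine (key (δ / (K * (2 * ‖e‖) + 1)) (by positivity)).trans ?_
  have h1 : (K : ℝ) * (2 * (δ / (K * (2 * ‖e‖) + 1)) * ‖e‖) =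
      (K * (2 * ‖e‖)) / (K * (2 * ‖e‖) + 1) * δ := by ring
  have h2 : (K * (2 * ‖e‖)) / (K * (2 * ‖e‖) + 1) ≤ 1 := by
    rw [div_le_one hpos]
    linarith
  rw [h1]
  linarith [mul_le_mul_of_nonneg_right h2 hδ.le]

/-! ### Solutions as functionals on differences of support functions -/

/-- Functions on the orthant of weights. -/
abbrev WeightFn (n : ℕ) : Type := (Fin n → ℝ≥0) → ℝ

/-- The vector lattice of differences of support functions of bargaining sets. -/
def supportDiff (n : ℕ) : AddSubgroup (WeightFn n) where
  carrier := {f | ∃ B C : BargainingSet n, f = supportFn B - supportFn C}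
  zero_mem' := ⟨orthant 0, orthant 0, (sub_self _).symm⟩
  add_mem' := by
    rintro _ _ ⟨B, C, rfl⟩ ⟨B', C', rfl⟩
    refine ⟨B + B', C + C', ?_⟩
    ext w
    simp only [Pi.add_apply, Pi.sub_apply, supportFn_add]
    ring
  neg_mem' := by
    rintro _ ⟨B, C, rfl⟩
    exact ⟨C, B, neg_sub _ _⟩

theorem sup_mem_supportDiff {f g : WeightFn n} (hf : f ∈ supportDiff n) (hg : g ∈ supportDiff n) :
    f ⊔ g ∈ supportDiff n := by
  obtain ⟨B, C, rfl⟩ := hf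
  obtain ⟨B', C', rfl⟩ := hg
  obtain ⟨D, hD⟩ := exists_supportFn_eq_sup (B + C') (B' + C)
  refine ⟨D, C + C', ?_⟩
  ext w
  simp only [hD, Pi.sup_apply, Pi.sub_apply, supportFn_add]
  rw [← max_sub_sub_right]
  congr 1 <;> ring

theorem inf_mem_supportDiff {f g : WeightFn n} (hf : f ∈ supportDiff n) (hg : g ∈ supportDiff n) :
    f ⊓ g ∈ supportDiff n := by
  have := neg_mem (sup_mem_supportDiff (neg_mem hf) (neg_mem hg))
  rwa [← neg_inf, neg_neg] at this

theorem comp_restrict_mem_supportDiff {f : WeightFn n} (hf : f ∈ supportDiff n)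
    (T : Finset (Fin n)) : f ∘ restrict T ∈ supportDiff n := by
  obtain ⟨B, C, rfl⟩ := hf
  obtain ⟨B', hB, -⟩ := exists_supportFn_eq_restrict B T
  obtain ⟨C', hC, -⟩ := exists_supportFn_eq_restrict C T
  refine ⟨B', C', ?_⟩
  ext w
  simp [hB, hC]

theorem mul_apply_mem_supportDiff (c : ℝ) (i : Fin n) :
    (fun w : Fin n → ℝ≥0 => c * w i) ∈ supportDiff n := by
  refine ⟨orthant (c • EuclideanSpace.single i 1), orthant 0, ?_⟩
  ext w
  have h : weighted w 0 = 0 := by simp [weighted]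
  simp [supportFn_orthant, weighted_smul, weighted_unit, h]

/-- The properties of the functionals on `supportDiff n`, one for each player, that a solution with
the six properties induces. -/
structure IsValueFunctional (L : Fin n → WeightFn n → ℝ) : Prop where
  add : ∀ i, ∀ f ∈ supportDiff n, ∀ g ∈ supportDiff n, L i (f + g) = L i f + L i g
  sum_eq : ∀ f ∈ supportDiff n, ∑ i, L i f = f 1
  dummy : ∀ i, ∀ f ∈ supportDiff n, (∀ w, f (restrict {i}ᶜ w) = f w) → L i f = 0
  symm : ∀ i (ρ : Equiv.Perm (Fin n)), ∀ f ∈ supportDiff n,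
    (∀ w, f (w ∘ ρ) = f w) → L i f = L (ρ i) f
  nonneg : ∀ i, ∀ f ∈ supportDiff n, (∀ w, 0 ≤ f w) → (∀ w : Fin n → ℝ≥0, w i = 0 → f w = 0) →
    0 ≤ L i f

open Classical in
/-- The additive extension of `ψ` to differences of support functions: `h_B - h_C` is sent to
`ψ B - ψ C`. Functions that are not such differences are sent to `0`. -/
def extension (ψ : BargainingSet n → Profile n) (i : Fin n) (f : WeightFn n) : ℝ :=
  if h : ∃ B C : BargainingSet n, f = supportFn B - supportFn C then
    ψ h.choose i - ψ h.choose_spec.choose i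
  else 0

theorem extension_sub {ψ : BargainingSet n → Profile n} (hadd : Additivity ψ) (i : Fin n)
    (B C : BargainingSet n) : extension ψ i (supportFn B - supportFn C) = ψ B i - ψ C i := by
  have h : ∃ B' C' : BargainingSet n, supportFn B - supportFn C = supportFn B' - supportFn C' :=
    ⟨B, C, rfl⟩
  rw [extension, dif_pos h]
  have h1 := h.choose_spec.choose_spec
  set B' := h.choose
  set C' := h.choose_spec.choose
  have h2 : B + C' = B' + C := by
    apply supportFn_injective
    ext w
    have := congrFun h1 w
    simp only [Pi.sub_apply] at this
    rw [supportFn_add, supportFn_add]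
    linarith
  have h3 := congrArg (fun x : Profile n => x i) ((hadd B C').symm.trans
    ((congrArg ψ h2).trans (hadd B' C)))
  simp only [PiLp.add_apply] at h3
  linarith

theorem isValueFunctional_extension {ψ : BargainingSet n → Profile n}
    (hsol : ∀ B, total Finset.univ (ψ B) = supportFn B 1) (hanon : Anonymity ψ)
    (hdummy : DummyProperty ψ) (hlip : LipschitzContinuity ψ) (hadd : Additivity ψ)
    (hmono : Monotonicity ψ) : IsValueFunctional (extension ψ) where
  add := by
    rintro i _ ⟨B, C, rfl⟩ _ ⟨B', C', rfl⟩
    have h : supportFn B - supportFn C + (supportFn B' - supportFn C') =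
        supportFn (B + B') - supportFn (C + C') := by
      ext w
      simp only [Pi.add_apply, Pi.sub_apply, supportFn_add]
      ring
    rw [h, extension_sub hadd, extension_sub hadd, extension_sub hadd, hadd, hadd]
    simp only [PiLp.add_apply]
    ring
  sum_eq := by
    rintro _ ⟨B, C, rfl⟩
    simp only [extension_sub hadd, Finset.sum_sub_distrib]
    exact congrArg₂ _ (hsol B) (hsol C)
  dummy := by
    rintro i _ ⟨B, C, rfl⟩ h
    obtain ⟨B', hB, hB0⟩ := exists_supportFn_eq_restrict B {i}ᶜ
    obtain ⟨C', hC, hC0⟩ := exists_supportFn_eq_restrict C {i}ᶜ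
    have : supportFn B - supportFn C = supportFn B' - supportFn C' := by
      ext w
      rw [← h]
      simp [hB, hC]
    rw [this, extension_sub hadd, hdummy B' i (hB0 i (by simp)), hdummy C' i (hC0 i (by simp)),
      sub_zero]
  symm := by
    rintro i ρ _ ⟨B, C, rfl⟩ h
    have : supportFn B - supportFn C =
        supportFn (permuteSet ρ B) - supportFn (permuteSet ρ C) := by
      ext w
      rw [← h]
      simp only [Pi.sub_apply, supportFn_permuteSet]
      have := h (w ∘ ρ.symm)
      have h2 : (w ∘ ρ.symm) ∘ ρ = w := by ext; simp
      rw [h2] at this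
      have h3 := h w
      simp only [Pi.sub_apply] at this h3
      linarith
    nth_rw 1 [this]
    rw [extension_sub hadd, extension_sub hadd, hanon, hanon]
    rfl
  nonneg := by
    rintro i _ ⟨B, C, rfl⟩ h h0
    rw [extension_sub hadd, sub_nonneg]
    exact apply_le_of_supportFn_le hmono hlip (fun w => sub_nonneg.1 (h w))
      fun w hw => sub_eq_zero.1 (h0 w hw)

/-! ### Uniqueness -/

namespace IsValueFunctional

variable {L L' : Fin n → WeightFn n → ℝ}

theorem map_zero (hL : IsValueFunctional L) (i : Fin n) : L i 0 = 0 := by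
  have := hL.add i 0 (zero_mem _) 0 (zero_mem _)
  rw [add_zero] at this
  linarith

theorem map_neg (hL : IsValueFunctional L) (i : Fin n) {f : WeightFn n} (hf : f ∈ supportDiff n) :
    L i (-f) = -L i f := by
  have := hL.add i f hf (-f) (neg_mem hf)
  rw [add_neg_cancel, hL.map_zero] at this
  linarith

/-- The functions at which two families of functionals agree. -/
def equalizer (hL : IsValueFunctional L) (hL' : IsValueFunctional L') :
    AddSubgroup (WeightFn n) where
  carrier := {f | f ∈ supportDiff n ∧ ∀ i, L i f = L' i f}
  zero_mem' := ⟨zero_mem _, fun i => by rw [hL.map_zero, hL'.map_zero]⟩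
  add_mem' := by
    rintro f g ⟨hf, hf'⟩ ⟨hg, hg'⟩
    exact ⟨add_mem hf hg, fun i => by rw [hL.add i f hf g hg, hL'.add i f hf g hg, hf', hg']⟩
  neg_mem' := by
    rintro f ⟨hf, hf'⟩
    exact ⟨neg_mem hf, fun i => by rw [hL.map_neg i hf, hL'.map_neg i hf, hf']⟩

theorem apply_eq_zero_of_notMem (hL : IsValueFunctional L) {T : Finset (Fin n)} {f : WeightFn n}
    (hf : f ∈ supportDiff n) (hT : ∀ w, f (restrict T w) = f w) {i : Fin n} (hi : i ∉ T) :
    L i f = 0 := by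
  refine hL.dummy i f hf fun w => ?_
  rw [← hT, restrict_restrict, Finset.inter_eq_left.2, hT]
  intro j hj
  simp only [Finset.mem_compl, Finset.mem_singleton]
  rintro rfl
  exact hi hj

/-- Players outside `T` are dummies for `f`, those in `T` get nonnegative amounts, and efficiency
makes these add up to `f 1 = 0`. -/
theorem apply_eq_zero_of_nonneg (hL : IsValueFunctional L) {T : Finset (Fin n)} {f : WeightFn n}
    (hf : f ∈ supportDiff n) (hT : ∀ w, f (restrict T w) = f w)
    (h0 : ∀ i ∈ T, ∀ w : Fin n → ℝ≥0, w i = 0 → f w = 0) (hpos : ∀ w, 0 ≤ f w) (h1 : f 1 = 0)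
    (i : Fin n) : L i f = 0 := by
  have hnn : ∀ i, 0 ≤ L i f := fun i => by
    by_cases hi : i ∈ T
    · exact hL.nonneg i f hf hpos (h0 i hi)
    · rw [hL.apply_eq_zero_of_notMem hf hT hi]
  have hs := hL.sum_eq f hf
  rw [h1, Finset.sum_eq_zero_iff_of_nonneg fun i _ => hnn i] at hs
  exact hs i (Finset.mem_univ i)

theorem apply_eq_zero (hL : IsValueFunctional L) {T : Finset (Fin n)} {f : WeightFn n}
    (hf : f ∈ supportDiff n) (hT : ∀ w, f (restrict T w) = f w)
    (h0 : ∀ i ∈ T, ∀ w : Fin n → ℝ≥0, w i = 0 → f w = 0) (h1 : f 1 = 0)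
    (i : Fin n) : L i f = 0 := by
  have hp : f ⊔ 0 ∈ supportDiff n := sup_mem_supportDiff hf (zero_mem _)
  have hm : -f ⊔ 0 ∈ supportDiff n := sup_mem_supportDiff (neg_mem hf) (zero_mem _)
  have hsplit : f + (-f ⊔ 0) = f ⊔ 0 := by
    ext w
    simp only [Pi.add_apply, Pi.sup_apply, Pi.neg_apply, Pi.zero_apply]
    rw [← max_add_add_left, add_neg_cancel, add_zero, max_comm]
  have h := hL.add i f hf _ hm
  rw [hsplit, hL.apply_eq_zero_of_nonneg (T := T) hp (fun w => by simp [hT])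
      (fun i hi w hw => by simp [h0 i hi w hw]) (fun w => by simp) (by simp [h1]),
    hL.apply_eq_zero_of_nonneg (T := T) hm (fun w => by simp [hT])
      (fun i hi w hw => by simp [h0 i hi w hw]) (fun w => by simp) (by simp [h1])] at h
  linarith

/-- The multiple `c * min_{i ∈ T} w i` of the unanimity function of `T`, a symmetric function in
the variables of `T`. -/
def unanimity (T : Finset (Fin n)) (hT : T.Nonempty) (c : ℝ) : WeightFn n :=
  fun w => c * (T.inf' hT w : ℝ≥0)

theorem unanimity_mem_supportDiff {T : Finset (Fin n)} (hT : T.Nonempty) (c : ℝ) :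
    unanimity T hT c ∈ supportDiff n := by
  have key : ∀ a : ℝ, 0 ≤ a → unanimity T hT a ∈ supportDiff n := by
    intro a ha
    have h : unanimity T hT a = T.inf' hT fun i w => a * (w i : ℝ) := by
      ext w
      rw [Finset.inf'_apply, unanimity]
      have hm : Monotone fun r : ℝ≥0 => a * (r : ℝ) := fun r s hrs =>
        mul_le_mul_of_nonneg_left (NNReal.coe_le_coe.2 hrs) ha
      exact Finset.apply_inf'_eq_inf'_comp hT (fun r : ℝ≥0 => a * (r : ℝ)) hm.map_inf
    rw [h]
    exact Finset.inf'_induction hT _ (fun f hf g hg => inf_mem_supportDiff hf hg)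
      fun i _ => mul_apply_mem_supportDiff a i
  rcases le_total 0 c with hc | hc
  · exact key c hc
  · have h : unanimity T hT c = -unanimity T hT (-c) := by
      ext w
      simp [unanimity]
    rw [h]
    exact neg_mem (key _ (neg_nonneg.2 hc))

theorem unanimity_restrict {T : Finset (Fin n)} (hT : T.Nonempty) (c : ℝ) (w : Fin n → ℝ≥0) :
    unanimity T hT c (restrict T w) = unanimity T hT c w := by
  have h : T.inf' hT (restrict T w) = T.inf' hT w :=
    Finset.inf'_congr hT rfl fun i hi => if_pos hi
  rw [unanimity, unanimity, h]

theorem card_mul_apply_unanimity (hL : IsValueFunctional L) {T : Finset (Fin n)}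
    (hT : T.Nonempty) (c : ℝ) {i : Fin n} (hi : i ∈ T) :
    T.card * L i (unanimity T hT c) = c := by
  have hmem := unanimity_mem_supportDiff hT c
  have hsym : ∀ j ∈ T, L j (unanimity T hT c) = L i (unanimity T hT c) := by
    intro j hj
    have h := hL.symm j (Equiv.swap i j) _ hmem fun w => ?_
    · rwa [Equiv.swap_apply_right] at h
    · have himg : T.image (Equiv.swap i j) = T := by
        have hsub : T.image (Equiv.swap i j) ⊆ T := by
          intro k hk
          obtain ⟨l, hl, rfl⟩ := Finset.mem_image.1 hk
          rw [Equiv.swap_apply_def]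
          split_ifs <;> assumption
        exact Finset.eq_of_subset_of_card_le hsub
          (Finset.card_image_of_injective _ (Equiv.swap i j).injective).ge
      have h2 : T.inf' hT (w ∘ Equiv.swap i j) = T.inf' hT w := by
        rw [← Finset.inf'_image (s := T) (f := Equiv.swap i j) (hT.image _) w]
        exact Finset.inf'_congr _ himg fun _ _ => rfl
      rw [unanimity, unanimity, h2]
  have hs := hL.sum_eq _ hmem
  rw [← Finset.sum_subset (Finset.subset_univ T) fun j _ hj =>
      hL.apply_eq_zero_of_notMem hmem (unanimity_restrict hT c) hj,
    Finset.sum_congr rfl hsym, Finset.sum_const, nsmul_eq_mul] at hs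
  rw [hs, unanimity]
  have h1 : T.inf' hT (1 : Fin n → ℝ≥0) = 1 := Finset.inf'_const hT 1
  rw [h1]
  simp

/-- Functions of the weights of `T` that vanish as soon as one of these weights does are determined
by their value at `1`: subtract a multiple of the unanimity function of `T`. -/
theorem mem_equalizer_of_restrict (hL : IsValueFunctional L) (hL' : IsValueFunctional L')
    {T : Finset (Fin n)} (hne : T.Nonempty) {f : WeightFn n} (hf : f ∈ supportDiff n)
    (hT : ∀ w, f (restrict T w) = f w)
    (h0 : ∀ i ∈ T, ∀ w : Fin n → ℝ≥0, w i = 0 → f w = 0) : f ∈ equalizer hL hL' := by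
  have humem := unanimity_mem_supportDiff hne (f 1)
  have hu : unanimity T hne (f 1) ∈ equalizer hL hL' := by
    refine ⟨humem, fun i => ?_⟩
    by_cases hi : i ∈ T
    · have hcard : (T.card : ℝ) ≠ 0 := by simpa using hne.ne_empty
      exact mul_left_cancel₀ hcard ((hL.card_mul_apply_unanimity hne _ hi).trans
        (hL'.card_mul_apply_unanimity hne _ hi).symm)
    · rw [hL.apply_eq_zero_of_notMem humem (unanimity_restrict hne _) hi,
        hL'.apply_eq_zero_of_notMem humem (unanimity_restrict hne _) hi]
  have hd : f - unanimity T hne (f 1) ∈ equalizer hL hL' := by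
    have hmem := sub_mem hf humem
    have hT' : ∀ w, (f - unanimity T hne (f 1)) (restrict T w) =
        (f - unanimity T hne (f 1)) w := fun w => by
      simp only [Pi.sub_apply, hT, unanimity_restrict]
    have h0' : ∀ i ∈ T, ∀ w : Fin n → ℝ≥0, w i = 0 → (f - unanimity T hne (f 1)) w = 0 := by
      intro i hi w hw
      have : T.inf' hne w = 0 := le_antisymm ((Finset.inf'_le _ hi).trans_eq hw) zero_le
      simp [unanimity, h0 i hi w hw, this]
    have h1' : (f - unanimity T hne (f 1)) 1 = 0 := by
      simp [unanimity]
    refine ⟨hmem, fun i => ?_⟩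
    rw [hL.apply_eq_zero hmem hT' h0' h1', hL'.apply_eq_zero hmem hT' h0' h1']
  simpa using add_mem hd hu

/-- Downward induction on `k`: subtracting from `f` its restrictions to the faces with `k` nonzero
weights leaves a function vanishing at all weights with at most `k` nonzero entries. -/
theorem mem_equalizer_of_vanish (hL : IsValueFunctional L) (hL' : IsValueFunctional L')
    {k : ℕ} (hk : k ≤ n + 1) {f : WeightFn n} (hf : f ∈ supportDiff n)
    (h : ∀ w : Fin n → ℝ≥0, (Finset.univ.filter fun i => w i ≠ 0).card < k → f w = 0) :
    f ∈ equalizer hL hL' := by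
  induction hk using Nat.decreasingInduction generalizing f with
  | self =>
    have : f = 0 := by
      ext w
      exact h w (Nat.lt_succ_of_le ((Finset.card_le_univ _).trans_eq (Fintype.card_fin n)))
    rw [this]
    exact zero_mem _
  | of_succ k hk ih =>
    let g : Finset (Fin n) → WeightFn n := fun T => f ∘ restrict T
    have hsupp : ∀ (T : Finset (Fin n)) (w : Fin n → ℝ≥0),
        (Finset.univ.filter fun i => restrict T w i ≠ 0) =
          T ∩ Finset.univ.filter fun i => w i ≠ 0 := by
      intro T w
      ext i
      simp [restrict]
    have hg : ∀ T ∈ Finset.univ.powersetCard k, g T ∈ equalizer hL hL' := by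
      intro T hT
      have hcard := (Finset.mem_powersetCard.1 hT).2
      rcases T.eq_empty_or_nonempty with rfl | hne
      · have : g ∅ = 0 := by
          obtain ⟨B, C, rfl⟩ := hf
          ext w
          have hw : restrict ∅ w = 0 := by
            ext i
            simp [restrict]
          simp [g, hw, supportFn_zero]
        rw [this]
        exact zero_mem _
      · refine mem_equalizer_of_restrict hL hL' hne (comp_restrict_mem_supportDiff hf T)
          (fun w => by simp [g, restrict_restrict]) fun i hi w hw => h _ ?_
        rw [hsupp, ← hcard]
        refine Finset.card_lt_card ⟨Finset.inter_subset_left, fun hsub => ?_⟩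
        have := hsub hi
        simp [hw] at this
    have hgsum : ∑ T ∈ Finset.univ.powersetCard k, g T ∈ equalizer hL hL' := sum_mem hg
    have hrest : f - ∑ T ∈ Finset.univ.powersetCard k, g T ∈ equalizer hL hL' := by
      refine ih (sub_mem hf hgsum.1) fun w hw => ?_
      rw [Pi.sub_apply, Finset.sum_apply, sub_eq_zero]
      set S := Finset.univ.filter fun i => w i ≠ 0 with hS
      have hzero : ∀ T ∈ Finset.univ.powersetCard k, T ≠ S → g T w = 0 := by
        intro T hT hTS
        have hcard := (Finset.mem_powersetCard.1 hT).2
        refine h _ ?_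
        rw [hsupp, ← hcard]
        refine Finset.card_lt_card ⟨Finset.inter_subset_left, fun hsub => hTS ?_⟩
        exact Finset.eq_of_subset_of_card_le (fun i hi => (Finset.mem_inter.1 (hsub hi)).2)
          (by omega)
      by_cases hk' : S.card = k
      · rw [Finset.sum_eq_single S hzero fun hn =>
          (hn (Finset.mem_powersetCard.2 ⟨Finset.subset_univ _, hk'⟩)).elim]
        have : restrict S w = w := by
          ext i
          by_cases hi : w i = 0 <;> simp [restrict, hS, hi]
        simp [g, this]
      · rw [Finset.sum_eq_zero fun T hT => hzero T hT ?_, h w (show S.card < k by omega)]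
        rintro rfl
        exact hk' (Finset.mem_powersetCard.1 hT).2
    simpa using add_mem hrest hgsum

theorem eq_on_supportDiff (hL : IsValueFunctional L) (hL' : IsValueFunctional L') {f : WeightFn n}
    (hf : f ∈ supportDiff n) (i : Fin n) : L i f = L' i f :=
  (mem_equalizer_of_vanish hL hL' (Nat.zero_le _) hf fun _ h => absurd h (Nat.not_lt_zero _)).2 i

end IsValueFunctional

/-! ### The Shapley value as a linear map -/

/-- The Shapley value, as a linear map on all set functions. -/
def shapleyMap (n : ℕ) : (Finset (Fin n) → ℝ) →ₗ[ℝ] Profile n where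
  toFun v := WithLp.toLp 2 fun i =>
    1 / (n : ℝ) * ∑ S ∈ (Finset.univ.erase i).powerset,
      (((n - 1).choose S.card : ℕ) : ℝ)⁻¹ * (v (insert i S) - v S)
  map_add' u v := by
    ext i
    simp only [PiLp.add_apply, Pi.add_apply, ← mul_add, ← Finset.sum_add_distrib]
    congr 1
    exact Finset.sum_congr rfl fun S _ => by ring
  map_smul' c v := by
    ext i
    simp only [PiLp.smul_apply, Pi.smul_apply, smul_eq_mul, RingHom.id_apply]
    rw [mul_left_comm]
    congr 1
    rw [Finset.mul_sum]
    exact Finset.sum_congr rfl fun S _ => by ring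

theorem shapleyMap_apply (v : Finset (Fin n) → ℝ) (i : Fin n) :
    shapleyMap n v i = 1 / (n : ℝ) * ∑ S ∈ (Finset.univ.erase i).powerset,
      (((n - 1).choose S.card : ℕ) : ℝ)⁻¹ * (v (insert i S) - v S) := rfl

theorem standAloneShapley_eq (B : BargainingSet n) :
    standAloneShapley B = shapleyMap n (claim B) := rfl

/-- The total weight that the Shapley values of all players put on the worth of a coalition of
`t` players: `1` for the grand coalition, `-1` for the empty one and `0` otherwise. -/
theorem shapley_weight_total {m t : ℕ} (ht : t ≤ m + 1) :
    (t : ℝ) * (1 / ((m + 1 : ℕ) : ℝ) * ((m.choose (t - 1) : ℕ) : ℝ)⁻¹) -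
      ((m + 1 - t : ℕ) : ℝ) * (1 / ((m + 1 : ℕ) : ℝ) * ((m.choose t : ℕ) : ℝ)⁻¹) =
    (if t = m + 1 then 1 else 0) - if t = 0 then 1 else 0 := by
  rcases t with _ | s
  · simp [show (m : ℝ) + 1 ≠ 0 by positivity]
  · rcases (Nat.succ_le_succ_iff.1 ht).eq_or_lt with rfl | hlt
    · simp [show (s : ℝ) + 1 ≠ 0 by positivity]
    · have h1 : ((m.choose s : ℕ) : ℝ) ≠ 0 := by
        exact_mod_cast (Nat.choose_pos hlt.le).ne'
      have h2 : ((m.choose (s + 1) : ℕ) : ℝ) ≠ 0 := by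
        exact_mod_cast (Nat.choose_pos hlt).ne'
      have h3 : ((m.choose (s + 1) : ℕ) : ℝ) * ((s + 1 : ℕ) : ℝ) =
          (m.choose s : ℕ) * ((m - s : ℕ) : ℝ) := by
        exact_mod_cast Nat.choose_succ_right_eq m s
      rw [if_neg (by omega), if_neg (by omega), show s + 1 - 1 = s from rfl,
        Nat.add_sub_add_right, sub_self]
      field_simp
      linarith

theorem sum_shapleyMap (v : Finset (Fin n) → ℝ) :
    ∑ i, shapleyMap n v i = v Finset.univ - v ∅ := by
  rcases n with _ | m
  · simp
  let q : ℕ → ℝ := fun k => 1 / ((m + 1 : ℕ) : ℝ) * ((m.choose k : ℕ) : ℝ)⁻¹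
  have h1 : ∀ i, shapleyMap (m + 1) v i =
      ∑ T with i ∈ T, q (T.card - 1) * v T - ∑ T with i ∉ T, q T.card * v T := by
    intro i
    have hpow : (Finset.univ.erase i).powerset = Finset.univ.filter fun T => i ∉ T := by
      ext T
      simp [Finset.subset_erase]
    have hins : ∑ T with i ∈ T, q (T.card - 1) * v T =
        ∑ T with i ∉ T, q T.card * v (insert i T) := by
      refine Finset.sum_nbij' (fun T => T.erase i) (fun T => insert i T) ?_ ?_ ?_ ?_ ?_
      · simp
      · simp
      · intro T hT
        exact Finset.insert_erase (by simpa using hT)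
      · intro T hT
        exact Finset.erase_insert (by simpa using hT)
      · intro T hT
        have hi : i ∈ T := by simpa using hT
        rw [Finset.insert_erase hi, Finset.card_erase_of_mem hi]
    rw [shapleyMap_apply, hpow, hins, ← Finset.sum_sub_distrib, Finset.mul_sum]
    refine Finset.sum_congr rfl fun T _ => ?_
    simp only [q, Nat.add_sub_cancel]
    ring
  have h2 : ∀ T : Finset (Fin (m + 1)),
      ∑ i, ((if i ∈ T then q (T.card - 1) * v T else 0) - if i ∉ T then q T.card * v T else 0) =
        (if T = Finset.univ then v T else 0) - if T = ∅ then v T else 0 := by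
    intro T
    have hT : T.card ≤ m + 1 := (Finset.card_le_univ T).trans_eq (Fintype.card_fin _)
    have huniv : T.card = m + 1 ↔ T = Finset.univ := by
      rw [← Finset.card_eq_iff_eq_univ, Fintype.card_fin]
    have hc : (Finset.univ.filter fun i => i ∉ T).card = m + 1 - T.card := by
      rw [Finset.filter_notMem_eq_sdiff, ← Finset.compl_eq_univ_sdiff, Finset.card_compl,
        Fintype.card_fin]
    have h3 := congrArg (· * v T) (shapley_weight_total hT)
    simp only [huniv, Finset.card_eq_zero, sub_mul, ite_mul, one_mul, zero_mul] at h3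
    rw [← h3, Finset.sum_sub_distrib, ← Finset.sum_filter, ← Finset.sum_filter, Finset.sum_const,
      Finset.sum_const, hc, Finset.filter_univ_mem, nsmul_eq_mul, nsmul_eq_mul]
    simp only [q]
    ring
  simp only [h1, Finset.sum_filter, ← Finset.sum_sub_distrib]
  rw [Finset.sum_comm]
  simp only [h2]
  rw [Finset.sum_sub_distrib]
  simp

theorem shapleyMap_comp_map (ρ : Equiv.Perm (Fin n)) (v : Finset (Fin n) → ℝ) :
    shapleyMap n (fun S => v (S.map ρ.toEmbedding)) = permute ρ (shapleyMap n v) := by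
  ext i
  change shapleyMap n _ i = shapleyMap n v (ρ i)
  rw [shapleyMap_apply, shapleyMap_apply]
  congr 1
  have hmem : ∀ S : Finset (Fin n), S ∈ (Finset.univ.erase i).powerset ↔
      S.map ρ.toEmbedding ∈ (Finset.univ.erase (ρ i)).powerset := by
    intro S
    simp [Finset.subset_erase]
  refine Finset.sum_equiv (Equiv.finsetCongr ρ) (by simpa using hmem) fun S _ => ?_
  simp [Finset.map_insert]

/-! ### The Shapley value of the stand-alone game has the six properties -/

theorem total_eq_weighted (S : Finset (Fin n)) : total S = weighted (restrict S 1) := by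
  ext x
  simp only [total, weighted, restrict, Pi.one_apply, apply_ite NNReal.toReal, NNReal.coe_one,
    NNReal.coe_zero, ite_mul, one_mul, zero_mul, Finset.sum_ite_mem, Finset.univ_inter]

theorem claim_eq_supportFn (B : BargainingSet n) (S : Finset (Fin n)) :
    claim B S = supportFn B (restrict S 1) := by
  rw [claim, supportFn, total_eq_weighted]

theorem restrict_univ_one : restrict Finset.univ (1 : Fin n → ℝ≥0) = 1 := by
  ext i
  simp [restrict]

theorem claim_empty (B : BargainingSet n) : claim B ∅ = 0 := by
  have h : total (∅ : Finset (Fin n)) = fun _ => 0 := by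
    ext x
    simp [total]
  rw [claim, h, B.nonempty.image_const, csSup_singleton]

theorem total_standAloneShapley (B : BargainingSet n) :
    total Finset.univ (standAloneShapley B) = claim B Finset.univ := by
  have h := sum_shapleyMap (claim B)
  rwa [claim_empty, sub_zero] at h

theorem anonymity_standAloneShapley : Anonymity (standAloneShapley (n := n)) := by
  intro ρ B
  rw [standAloneShapley_eq, standAloneShapley_eq, ← shapleyMap_comp_map]
  congr 1
  ext S
  rw [claim_eq_supportFn, claim_eq_supportFn, supportFn_permuteSet]
  congr 1
  ext i
  simp [restrict, Finset.mem_map_equiv]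

theorem additivity_standAloneShapley : Additivity (standAloneShapley (n := n)) := by
  intro B C
  rw [standAloneShapley_eq, standAloneShapley_eq, standAloneShapley_eq, ← map_add]
  congr 1
  ext S
  simp only [Pi.add_apply, claim_eq_supportFn, supportFn_add]

theorem exists_paretoFrontier_ge (B : BargainingSet n) {x : Profile n} (hx : x ∈ B.carrier) :
    ∃ y ∈ paretoFrontier B.carrier, ∀ i, x i ≤ y i := by
  obtain ⟨b, hb⟩ := B.boundedAbove
  have hI : IsCompact {y : Profile n | ∀ i, x i ≤ y i ∧ y i ≤ b i} := by
    have h1 : IsCompact (Set.Icc (fun i => x i) (fun i => b i) : Set (Fin n → ℝ)) := isCompact_Icc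
    convert h1.image (PiLp.continuous_toLp 2 fun _ : Fin n => ℝ) using 1
    ext y
    constructor
    · intro hy
      exact ⟨y.ofLp, ⟨fun i => (hy i).1, fun i => (hy i).2⟩, rfl⟩
    · rintro ⟨z, hz, rfl⟩ i
      exact ⟨hz.1 i, hz.2 i⟩
  obtain ⟨y, ⟨hyB, hy⟩, hmax⟩ := (hI.inter_left B.isClosed).exists_isMaxOn
    ⟨x, hx, fun i => ⟨le_rfl, hb x hx i⟩⟩ (continuous_weighted 1).continuousOn
  refine ⟨y, ⟨hyB, ?_⟩, fun i => (hy i).1⟩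
  rintro ⟨z, hz, hyz, hne⟩
  have h1 : weighted 1 z ≤ weighted 1 y :=
    hmax ⟨hz, fun i => ⟨(hy i).1.trans (hyz i), hb z hz i⟩⟩
  obtain ⟨i, hi⟩ : ∃ i, z i ≠ y i := by
    by_contra! h
    exact hne (by ext i; exact h i)
  have h2 : weighted 1 y < weighted 1 z := by
    refine Finset.sum_lt_sum (fun j _ => by simpa using hyz j) ⟨i, Finset.mem_univ i, ?_⟩
    simpa using (hyz i).lt_of_ne hi.symm
  exact h1.not_gt h2

theorem dummyProperty_standAloneShapley : DummyProperty (standAloneShapley (n := n)) := by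
  intro B i h
  have key : ∀ S ∈ (Finset.univ.erase i).powerset, claim B (insert i S) - claim B S = 0 := by
    intro S hS
    have hiS : i ∉ S := by simpa [Finset.subset_erase] using hS
    have htot : ∀ y ∈ paretoFrontier B.carrier,
        weighted (restrict (insert i S) 1) y = weighted (restrict S 1) y := by
      intro y hy
      rw [← total_eq_weighted, ← total_eq_weighted, total, total, Finset.sum_insert hiS, h y hy,
        zero_add]
    rw [sub_eq_zero, claim_eq_supportFn, claim_eq_supportFn]
    apply le_antisymm <;> refine supportFn_le_iff.2 fun x hx => ?_ <;>
      obtain ⟨y, hy, hxy⟩ := exists_paretoFrontier_ge B hx <;>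
      refine (weighted_mono _ hxy).trans ?_
    · rw [htot y hy]
      exact weighted_le_supportFn _ hy.1
    · rw [← htot y hy]
      exact weighted_le_supportFn _ hy.1
  rw [standAloneShapley_eq, shapleyMap_apply,
    Finset.sum_eq_zero fun S hS => by rw [key S hS, mul_zero], mul_zero]

theorem monotonicity_standAloneShapley : Monotonicity (standAloneShapley (n := n)) := by
  rintro B i x ⟨y, hy, -, hyx⟩
  have hsub : B.carrier ⊆ (adjoin B x).carrier := fun z hz D hD => hD (Or.inr hz)
  have key : ∀ S : Finset (Fin n), i ∉ S → claim (adjoin B x) S ≤ claim B S := by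
    intro S hiS
    -- The total utility of `S` at the new point equals that at `y`, as `i` is not in `S`.
    have hx : weighted (restrict S 1) x ≤ supportFn B (restrict S 1) := by
      have : weighted (restrict S 1) x = weighted (restrict S 1) y := by
        rw [← total_eq_weighted]
        exact Finset.sum_congr rfl fun j hj => (hyx j fun h => hiS (h ▸ hj)).symm
      rw [this]
      exact weighted_le_supportFn _ hy
    have hB : ∀ z ∈ B.carrier, ∀ w, weighted w z ≤ max (supportFn B w) (weighted w x) :=
      fun z hz w => (weighted_le_supportFn w hz).trans (le_max_left _ _)
    let D := ofBounds (fun w => max (supportFn B w) (weighted w x)) ⟨y, hB y hy⟩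
    have hD : insert x B.carrier ⊆ D.carrier := by
      rintro z (rfl | hz)
      · exact fun w => le_max_right _ _
      · exact hB z hz
    rw [claim_eq_supportFn, claim_eq_supportFn]
    exact supportFn_le_iff.2 fun z hz => (hz D hD _).trans (max_le le_rfl hx)
  rw [standAloneShapley_eq, standAloneShapley_eq, shapleyMap_apply, shapleyMap_apply]
  refine mul_le_mul_of_nonneg_left (Finset.sum_le_sum fun S hS => ?_) (by positivity)
  have hiS : i ∉ S := by simpa [Finset.subset_erase] using hS
  have h1 : claim B (insert i S) ≤ claim (adjoin B x) (insert i S) := by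
    rw [claim_eq_supportFn, claim_eq_supportFn]
    exact supportFn_mono hsub _
  exact mul_le_mul_of_nonneg_left (by linarith [key S hiS]) (by positivity)

theorem claim_le_add {B C : BargainingSet n} (S : Finset (Fin n)) {r : ℝ≥0}
    (h : Metric.hausdorffEDist B.carrier C.carrier < r) : claim B S ≤ claim C S + n * r := by
  rw [claim_eq_supportFn, claim_eq_supportFn]
  refine supportFn_le_iff.2 fun x hx => ?_
  obtain ⟨y, hy, hxy⟩ := Metric.exists_edist_lt_of_hausdorffEDist_lt hx h
  have hd : ‖x - y‖ < r := by
    rw [← dist_eq_norm]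
    rw [edist_dist, ← ENNReal.ofReal_coe_nnreal] at hxy
    exact (ENNReal.ofReal_lt_ofReal_iff_of_nonneg dist_nonneg).1 hxy
  have h1 : weighted (restrict S 1) (x - y) ≤ n * r := by
    rw [← total_eq_weighted]
    calc ∑ i ∈ S, (x - y) i ≤ ∑ i ∈ S, (r : ℝ) := Finset.sum_le_sum fun i _ =>
          ((le_abs_self _).trans (PiLp.norm_apply_le (x - y) i)).trans hd.le
      _ ≤ n * r := by
          rw [Finset.sum_const, nsmul_eq_mul]
          refine mul_le_mul_of_nonneg_right ?_ r.coe_nonneg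
          exact_mod_cast (Finset.card_le_univ S).trans_eq (Fintype.card_fin n)
  rw [weighted_sub] at h1
  linarith [weighted_le_supportFn (restrict S 1) hy]

theorem lipschitzContinuity_standAloneShapley :
    LipschitzContinuity (standAloneShapley (n := n)) := by
  let A := LinearMap.toContinuousLinearMap (shapleyMap n)
  -- The summand `1` makes the constant positive, so that it does not matter whether the Hausdorff
  -- distance is finite.
  refine ⟨‖A‖₊ * n + 1, fun B C => ?_⟩
  have key : ∀ r : ℝ≥0, Metric.hausdorffEDist B.carrier C.carrier < r →
      edist (standAloneShapley B) (standAloneShapley C) ≤ ((‖A‖₊ * n + 1 : ℝ≥0) : ℝ≥0∞) * r := by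
    intro r hr
    have h1 : dist (claim B) (claim C) ≤ n * r := by
      refine (dist_pi_le_iff (by positivity)).2 fun S => ?_
      rw [Real.dist_eq, abs_sub_le_iff]
      have h2 := claim_le_add S hr
      have h3 := claim_le_add S ((Metric.hausdorffEDist_comm).trans_lt hr)
      constructor <;> linarith
    have h2 : dist (A (claim B)) (A (claim C)) ≤ ‖A‖ * dist (claim B) (claim C) :=
      A.lipschitz.dist_le_mul _ _
    have h3 : dist (A (claim B)) (A (claim C)) ≤ ((‖A‖₊ * n + 1) * r : ℝ≥0) := by
      refine (h2.trans (mul_le_mul_of_nonneg_left h1 (norm_nonneg _))).trans ?_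
      push_cast
      have := r.coe_nonneg
      nlinarith
    rw [edist_dist, ← ENNReal.coe_mul, ← ENNReal.ofReal_coe_nnreal]
    exact ENNReal.ofReal_le_ofReal h3
  rcases eq_or_ne (Metric.hausdorffEDist B.carrier C.carrier) ⊤ with htop | hfin
  · rw [htop, ENNReal.mul_top (by simp)]
    exact le_top
  · lift Metric.hausdorffEDist B.carrier C.carrier to ℝ≥0 using hfin with d
    rw [← ENNReal.coe_mul]
    have hc : Continuous fun r : ℝ≥0 => (‖A‖₊ * n + 1) * r := by fun_prop
    have hlim : Filter.Tendsto (fun r : ℝ≥0 => (((‖A‖₊ * n + 1) * r : ℝ≥0) : ℝ≥0∞))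
        (nhdsWithin d (Set.Ioi d)) (nhds (((‖A‖₊ * n + 1) * d : ℝ≥0) : ℝ≥0∞)) :=
      ENNReal.tendsto_coe.2 (hc.tendsto d |>.mono_left nhdsWithin_le_nhds)
    refine ge_of_tendsto hlim ?_
    filter_upwards [self_mem_nhdsWithin] with r hr
    rw [ENNReal.coe_mul]
    exact key r (ENNReal.coe_lt_coe.2 hr)

theorem isValueFunctional_standAloneShapley :
    IsValueFunctional (extension (standAloneShapley (n := n))) :=
  isValueFunctional_extension
    (fun B => by rw [total_standAloneShapley, claim_eq_supportFn, restrict_univ_one])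
    anonymity_standAloneShapley dummyProperty_standAloneShapley
    lipschitzContinuity_standAloneShapley additivity_standAloneShapley
    monotonicity_standAloneShapley

end SocialChoice

end

theorem theorem1 (n : ℕ) (ψ : SocialChoice.BargainingSet n → SocialChoice.Profile n) :
    (SocialChoice.IsSolution ψ ∧
      SocialChoice.Efficiency ψ ∧
      SocialChoice.Anonymity ψ ∧
      SocialChoice.DummyProperty ψ ∧
      SocialChoice.LipschitzContinuity ψ ∧
      SocialChoice.Additivity ψ ∧
      SocialChoice.Monotonicity ψ) ↔
    ψ = SocialChoice.standAloneShapley := by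
  open SocialChoice in
  constructor
  · rintro ⟨hsol, heff, hanon, hdummy, hlip, hadd, hmono⟩
    have htot : ∀ B, total Finset.univ (ψ B) = supportFn B 1 := by
      intro B
      have h1 := claim_eq_supportFn B Finset.univ
      rw [restrict_univ_one] at h1
      refine le_antisymm ((hsol B).trans_eq h1) (supportFn_le_iff.2 fun x hx => ?_)
      simpa [total_eq_weighted, restrict_univ_one] using heff B x hx
    have hψ := isValueFunctional_extension htot hanon hdummy hlip hadd hmono
    -- Additivity forces both solutions to vanish at the zero orthant, whose support function is `0`.
    have hzero : ∀ φ : BargainingSet n → Profile n, Additivity φ → ∀ i, φ (orthant 0) i = 0 := by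
      intro φ hφ i
      have h0 : orthant (0 : Profile n) + orthant 0 = orthant 0 :=
        supportFn_injective <| by
          ext w
          simp [supportFn_add, supportFn_orthant, weighted]
      have h1 := congrArg (fun x : Profile n => x i) ((hφ (orthant 0) (orthant 0)).symm.trans
        (congrArg φ h0))
      simpa using h1
    funext B
    ext i
    have h := hψ.eq_on_supportDiff isValueFunctional_standAloneShapley
      (f := supportFn B - supportFn (orthant 0)) ⟨B, orthant 0, rfl⟩ i
    rwa [extension_sub hadd, extension_sub additivity_standAloneShapley, hzero ψ hadd,
      hzero _ additivity_standAloneShapley, sub_zero, sub_zero] at h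
  · rintro rfl
    refine ⟨fun B => (total_standAloneShapley B).le, fun B x hx => ?_, anonymity_standAloneShapley,
      dummyProperty_standAloneShapley, lipschitzContinuity_standAloneShapley,
      additivity_standAloneShapley, monotonicity_standAloneShapley⟩
    rw [total_standAloneShapley, claim_eq_supportFn, total_eq_weighted]
    exact weighted_le_supportFn _ hx
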